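/- There are constants $\delta>0$ and $C$ and a randomized algorithm with the following property. Let $\mathcal M_1,\mathcal M_2$ be any two matroids on a common finite ground set $E=\{0,\dots,m-1\}$ of size $m$. Given $m$ and access to the independence oracles of $\mathcal M_1$ and $\mathcal M_2$ (an oracle call asks, for one of the two matroids, whether the set whose indicator vector is stored in a given array is independent), the algorithm runs in linear time: for every outcome of its coin tosses it makes at most $C\,m$ oracle calls and halts after at most $C\,(m+1)$ elementary steps, each oracle call and each coin toss being counted as one step. For every outcome of its coin tosses it outputs a set $A\subseteq E$ that is independent in both $\mathcal M_1$ and $\mathcal M_2$, and the expected size of $A$ over its (independent, fair) coin tosses satisfies $$\mathbb E\,|A|\;\ge\;\Bigl(\tfrac12+\delta\Bigr)\max\{|I| : I \text{ independent in both } \mathcal M_1 \text{ and } \mathcal M_2\}.$$ Here an algorithm is a single fixed program, the same for all $m$, $\mathcal M_1$, $\mathcal M_2$, in an imperative language with finitely many integer variables and arrays, whose instructions are assignment, increment, decrement, comparison, array access, a fair coin toss, an oracle call, and if/while control flow. -/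

import Mathlib

/-! A concrete randomized machine with access to two independence oracles. Programs are finite
objects that do not depend on the input; every executed instruction is charged one step. -/

namespace MatroidIntersection

/-- The instructions of an imperative language with variables `x, y, z` (natural numbers) and
arrays `a` (of natural numbers). The only arithmetic is successor and predecessor, so that after
`t` steps on a ground set of size `n` every number occurring is at most `n + t` plus a constant
of the program: the unit-cost convention hides no long arithmetic. -/
inductive Cmd : Type
  | skip : Cmd
  /-- `x := k` -/
  | const (x k : ℕ) : Cmd
  /-- `x := y` -/
  | copy (x y : ℕ) : Cmd
  /-- `x := x + 1` -/
  | succ (x : ℕ) : Cmd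
  /-- `x := x - 1`, where `0 - 1 = 0` -/
  | pred (x : ℕ) : Cmd
  /-- `x := 1` if `y ≤ z`, and `x := 0` otherwise -/
  | le (x y z : ℕ) : Cmd
  /-- `x := a[y]` -/
  | load (x a y : ℕ) : Cmd
  /-- `a[x] := y` -/
  | store (a x y : ℕ) : Cmd
  /-- `x :=` the next bit of the random tape -/
  | toss (x : ℕ) : Cmd
  /-- `x := 1` if the set whose indicator is stored in the array `a` is independent in the
  `i`-th matroid, and `x := 0` otherwise -/
  | query (i : Fin 2) (x a : ℕ) : Cmd
  | seq (c d : Cmd) : Cmd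
  /-- run `c` if `x ≠ 0`, and `d` otherwise -/
  | ite (x : ℕ) (c d : Cmd) : Cmd
  /-- as long as `x ≠ 0`, run `c` -/
  | loop (x : ℕ) (c : Cmd) : Cmd

/-- The memory of the machine, with the position on the random tape and the number of oracle
calls made so far. -/
structure State : Type where
  var : ℕ → ℕ
  arr : ℕ → ℕ → ℕ
  coins : ℕ
  queries : ℕ

/-- The initial memory on a ground set of size `n`: variable `0` holds `n`, all else is `0`. -/
def State.init (n : ℕ) : State where
  var := Function.update (fun _ => 0) 0 n
  arr := fun _ _ => 0
  coins := 0
  queries := 0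

/-- `x := v` -/
def State.set (s : State) (x v : ℕ) : State :=
  { s with var := Function.update s.var x v }

/-- The subset of the ground set `{0, …, n - 1}` whose indicator is stored in the array `a`. -/
def State.toSet (s : State) (n a : ℕ) : Finset (Fin n) :=
  Finset.univ.filter fun e : Fin n => s.arr a e ≠ 0

/-- A configuration: the commands still to be executed, and the memory. -/
abbrev Config : Type := List Cmd × State

/-- One step of the machine, with oracles `O 0`, `O 1` and random tape `ω`. The machine has halted
when no command is left. -/
def step {n : ℕ} (O : Fin 2 → Finset (Fin n) → Bool) (ω : ℕ → Bool) : Config → Config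
  | ([], s) => ([], s)
  | (Cmd.skip :: K, s) => (K, s)
  | (Cmd.const x k :: K, s) => (K, s.set x k)
  | (Cmd.copy x y :: K, s) => (K, s.set x (s.var y))
  | (Cmd.succ x :: K, s) => (K, s.set x (s.var x + 1))
  | (Cmd.pred x :: K, s) => (K, s.set x (s.var x - 1))
  | (Cmd.le x y z :: K, s) => (K, s.set x (if s.var y ≤ s.var z then 1 else 0))
  | (Cmd.load x a y :: K, s) => (K, s.set x (s.arr a (s.var y)))
  | (Cmd.store a x y :: K, s) =>
      (K, { s with arr := Function.update s.arr a
                            (Function.update (s.arr a) (s.var x) (s.var y)) })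
  | (Cmd.toss x :: K, s) =>
      (K, { s.set x (if ω s.coins then 1 else 0) with coins := s.coins + 1 })
  | (Cmd.query i x a :: K, s) =>
      (K, { s.set x (if O i (s.toSet n a) then 1 else 0) with queries := s.queries + 1 })
  | (Cmd.seq c d :: K, s) => (c :: d :: K, s)
  | (Cmd.ite x c d :: K, s) => ((if s.var x ≠ 0 then c else d) :: K, s)
  | (Cmd.loop x c :: K, s) => (if s.var x ≠ 0 then c :: Cmd.loop x c :: K else K, s)

/-- The configuration after `t` steps of the program `P`. -/
def run {n : ℕ} (P : Cmd) (O : Fin 2 → Finset (Fin n) → Bool) (ω : ℕ → Bool) (t : ℕ) : Config :=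
  (step O ω)^[t] ([P], State.init n)

/-- The set that the program `P` has written to the output array `0` after `t` steps. -/
def output {n : ℕ} (P : Cmd) (O : Fin 2 → Finset (Fin n) → Bool) (ω : ℕ → Bool) (t : ℕ) :
    Finset (Fin n) :=
  (run P O ω t).2.toSet n 0

/-- The random tape that starts with the `t` bits `w`. -/
def tape {t : ℕ} (w : Fin t → Bool) : ℕ → Bool :=
  fun k => if h : k < t then w ⟨k, h⟩ else false

/-- The expected size of the output after `t` steps, for independent fair random bits. At most
`t` bits can be read in `t` steps, so this is an average over `{0, 1} ^ t`. -/
noncomputable def expectedSize {n : ℕ} (P : Cmd) (O : Fin 2 → Finset (Fin n) → Bool) (t : ℕ) : ℝ :=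
  (∑ w : Fin t → Bool, ((output P O (tape w) t).card : ℝ)) / 2 ^ t

open Classical in
/-- The independence oracles of two matroids. -/
noncomputable def indepOracle {n : ℕ} (M : Fin 2 → Matroid (Fin n)) :
    Fin 2 → Finset (Fin n) → Bool :=
  fun i S => decide ((M i).Indep (S : Set (Fin n)))

open Classical in
/-- The maximum size of a common independent set. -/
noncomputable def opt {n : ℕ} (M : Fin 2 → Matroid (Fin n)) : ℕ :=
  (Finset.univ.filter fun I : Finset (Fin n) => ∀ i, (M i).Indep (I : Set (Fin n))).sup Finset.card

end MatroidIntersection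

/-! Let `T` be the greedy common independent set and `O` an optimal one. Maximality of `T` gives
only `|O| ≤ 2|T|`, so `T` has to be improved when it is near half of the optimum. Choose a random `S
⊆ T`, keeping each element with probability 1/2. Let `A` be a greedy common independent set of `M₁ ／
T` and `M₂ ／ S`, let `B` be the same with the matroids interchanged, and return `S ∪ A ∪ B`.

This set is independent in `M₂`: each element of `A` extends `T` in `M₁`, so by maximality `T` spans
it in `M₂`. Thus `T` spans `S ∪ A` in `M₂`, and `T ∪ B` is independent there, so `T` may be replaced
by `S ∪ A` (`indep_union_of_spanned`). The argument for `M₁` is symmetric.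

For the size, `card_le_three_mul_sum_card_greedy` gives `E|A| ≥ (|O| - |T|) / 3`. The coins of `T`
are revealed only when they matter for the element at hand. An accepted element destroys at most two
elements of the remaining solution, one per matroid. If a coin decides, the outcome that accepts
leaves a surplus of one, and this pays for the other outcome, in which contracting one more element
destroys at most one.

The random branch therefore has expected size at least `|T|/2 + 2(|O| - |T|)/3`. It is good when `T`
is small, while `S = T` is good when `T` is large. A further fair coin choosing between the two
gives the average `|O|/3 + 5|T|/12 ≥ 13|O|/24`. Each of the three greedy passes asks at most two
oracle questions per element. -/

namespace MatroidIntersection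

/-! ### Exchange properties of independent finsets -/

section Exchange

variable {α : Type*} [DecidableEq α] {M : Matroid α}

lemma exists_augmentation (O : Finset α) (hO : M.Indep (O : Set α)) :
    ∀ T : Finset α, M.Indep (T : Set α) →
      ∃ I ⊆ O, Disjoint I T ∧ M.Indep ((T ∪ I : Finset α) : Set α) ∧ O.card ≤ T.card + I.card := by
  suffices h : ∀ (k : ℕ) (T : Finset α), O.card ≤ T.card + k → M.Indep (T : Set α) →
      ∃ I ⊆ O, Disjoint I T ∧ M.Indep ((T ∪ I : Finset α) : Set α) ∧
        O.card ≤ T.card + I.card from fun T hT => h O.card T (by omega) hT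
  intro k
  induction k with
  | zero => exact fun T hk hT => ⟨∅, by simp, by simp, by simpa using hT, by simpa using hk⟩
  | succ k ih =>
    intro T hk hT
    by_cases hcard : O.card ≤ T.card
    · exact ⟨∅, by simp, by simp, by simpa using hT, by simpa using hcard⟩
    obtain ⟨e, heO, heT, he⟩ := hT.augment_finset hO (by omega)
    have hc := Finset.card_insert_of_notMem heT
    obtain ⟨I, hIsub, hdis, hI, hIc⟩ := ih (insert e T) (by omega) (by simpa using he)
    rw [Finset.disjoint_insert_right] at hdis
    refine ⟨insert e I, Finset.insert_subset heO hIsub, ?_, ?_, ?_⟩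
    · rw [Finset.disjoint_insert_left]
      exact ⟨heT, hdis.2⟩
    · rwa [Finset.union_insert, ← Finset.insert_union]
    · rw [Finset.card_insert_of_notMem hdis.1]
      omega

/-- Contracting one more element `e` costs an independent set of `M ／ X` at most one element:
augment `insert e X` from `X ∪ I`. Disjointness and a union express independence in a contraction
without forming it. -/
lemma exists_exchange {X I : Finset α} {e : α} (hXI : M.Indep ((X ∪ I : Finset α) : Set α))
    (hdis : Disjoint I X) (he : M.Indep ((insert e X : Finset α) : Set α)) :
    ∃ J ⊆ I, Disjoint J (insert e X) ∧ M.Indep ((insert e X ∪ J : Finset α) : Set α) ∧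
      I.card ≤ J.card + 1 := by
  obtain ⟨J, hJ, hd, hi, hc⟩ := exists_augmentation _ hXI _ he
  refine ⟨J, fun x hx => ?_, hd, hi, ?_⟩
  · have h1 := hJ hx
    have h2 := Finset.disjoint_left.1 hd hx
    simp only [Finset.mem_union, Finset.mem_insert, not_or] at h1 h2
    tauto
  · rw [Finset.card_union_of_disjoint hdis.symm] at hc
    have := Finset.card_insert_le e X
    omega

/-- The element `t` lies on the circuit that `e` closes in `X ∪ U`; since `X` does not span `e`,
this circuit meets `U \ X`. In the greedy analysis, the coin of `t` is the next one to reveal. -/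
lemma exists_erase_indep {X U : Finset α} {e : α}
    (hXU : M.Indep ((X ∪ U : Finset α) : Set α)) (he : M.Indep ((insert e X : Finset α) : Set α))
    (hdep : ¬ M.Indep ((insert e (X ∪ U) : Finset α) : Set α)) :
    ∃ t ∈ U, t ∉ X ∧ M.Indep ((insert e (X ∪ U.erase t) : Finset α) : Set α) := by
  have hX : X ∪ (U \ X) = X ∪ U := Finset.union_sdiff_self_eq_union
  obtain ⟨J, hJ, -, hi, hc⟩ := exists_exchange (I := U \ X) (by rwa [hX])
    Finset.sdiff_disjoint he
  have hne : J ≠ U \ X := by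
    rintro rfl
    rw [Finset.insert_union, hX] at hi
    exact hdep hi
  obtain ⟨t, ht, htJ⟩ := Finset.exists_of_ssubset (hJ.ssubset_of_ne hne)
  -- `J` is proper and lacks at most one element, so it lacks exactly `t`.
  have hJeq : J = (U \ X).erase t := by
    apply Finset.eq_of_subset_of_card_le
    · exact fun x hx => Finset.mem_erase.2 ⟨fun h => htJ (h ▸ hx), hJ hx⟩
    · rw [Finset.card_erase_of_mem ht]
      omega
  rw [Finset.mem_sdiff] at ht
  refine ⟨t, ht.1, ht.2, hi.subset ?_⟩
  rw [Finset.coe_subset, hJeq]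
  intro x
  simp only [Finset.mem_insert, Finset.mem_union, Finset.mem_erase, Finset.mem_sdiff]
  tauto

lemma card_le_of_forall_not_indep {T X : Finset α} (hT : M.Indep (T : Set α))
    (hX : M.Indep (X : Set α))
    (h : ∀ x ∈ X, x ∉ T → ¬ M.Indep ((insert x T : Finset α) : Set α)) : X.card ≤ T.card := by
  by_contra! hlt
  obtain ⟨e, heX, heT, he⟩ := hT.augment_finset hX hlt
  exact h e heX heT (by simpa using he)

/-- Augment `X` from `T ∪ B`. What is added from `T` together with `X` has size at most `|T|`,
because `T` spans all of it, so counting forces every element of `B` to be added. -/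
lemma indep_union_of_spanned {T X B : Finset α} (hTB : M.Indep ((T ∪ B : Finset α) : Set α))
    (hdis : Disjoint T B) (hX : M.Indep (X : Set α))
    (h : ∀ x ∈ X, x ∉ T → ¬ M.Indep ((insert x T : Finset α) : Set α)) :
    M.Indep ((X ∪ B : Finset α) : Set α) := by
  obtain ⟨J, hJ, hd, hi, hc⟩ := exists_augmentation _ hTB _ hX
  have hT : M.Indep (T : Set α) := hTB.subset (by simp)
  have h1 : (X ∪ J ∩ T).card ≤ T.card := by
    refine card_le_of_forall_not_indep hT (hi.subset ?_) fun x hx hxT => ?_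
    · rw [Finset.coe_subset]
      exact Finset.union_subset_union_right Finset.inter_subset_left
    · simp only [Finset.mem_union, Finset.mem_inter] at hx
      exact h x (by tauto) hxT
  rw [Finset.card_union_of_disjoint (hd.symm.mono_right Finset.inter_subset_left)] at h1
  rw [Finset.card_union_of_disjoint hdis] at hc
  have h2 := Finset.card_inter_add_card_sdiff J T
  have h3 : J \ T ⊆ B := fun x hx => by
    rw [Finset.mem_sdiff] at hx
    exact (Finset.mem_union.1 (hJ hx.1)).resolve_left hx.2
  have h4 : J \ T = B := Finset.eq_of_subset_of_card_le h3 (by omega)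
  refine hi.subset ?_
  rw [Finset.coe_subset, ← h4]
  exact Finset.union_subset_union_right Finset.sdiff_subset

end Exchange

/-! ### Averages over coin tosses -/

section Coins

variable {ι : Type*} [DecidableEq ι]

/-- Conditioning on coin `j`: flipping it is an involution that pairs the two outcomes. -/
lemma two_mul_sum_eq_sum_update [Fintype ι] (j : ι) (g : (ι → Bool) → ℕ) :
    2 * ∑ w, g w = ∑ w, g (Function.update w j true) + ∑ w, g (Function.update w j false) := by
  have hflip : Function.Involutive fun w : ι → Bool => Function.update w j (!w j) := by
    intro w
    simp
  have h1 : ∑ w, g (Function.update w j (!w j)) = ∑ w, g w :=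
    Equiv.sum_comp hflip.toPerm g
  rw [two_mul]
  nth_rewrite 2 [← h1]
  rw [← Finset.sum_add_distrib, ← Finset.sum_add_distrib]
  refine Finset.sum_congr rfl fun w _ => ?_
  have h2 : Function.update w j (w j) = w := Function.update_eq_self j w
  cases hw : w j <;> rw [hw] at h2 <;> simp [h2, add_comm]

/-- The elements whose coin shows `false`. -/
def unmarked {α : Type*} (idx : α → ι) (w : ι → Bool) (U : Finset α) : Finset α :=
  U.filter fun u => w (idx u) = false

variable {α : Type*} {idx : α → ι}

lemma unmarked_update_true [DecidableEq α] (hidx : Function.Injective idx) (w : ι → Bool)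
    (U : Finset α) (t : α) :
    unmarked idx (Function.update w (idx t) true) U = unmarked idx w (U.erase t) := by
  ext u
  by_cases h : u = t
  · simp [unmarked, h]
  · simp [unmarked, h, hidx.eq_iff]

lemma unmarked_update_false [DecidableEq α] (hidx : Function.Injective idx) (w : ι → Bool)
    {U : Finset α} {t : α} (ht : t ∈ U) :
    unmarked idx (Function.update w (idx t) false) U = insert t (unmarked idx w (U.erase t)) := by
  ext u
  by_cases h : u = t
  · simp [unmarked, h, ht]
  · simp [unmarked, h, hidx.eq_iff]

lemma unmarked_update_of_notMem_range {j : ι} (hj : ∀ u, idx u ≠ j) (w : ι → Bool) (b : Bool)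
    (U : Finset α) : unmarked idx (Function.update w j b) U = unmarked idx w U := by
  simp [unmarked, hj]

lemma two_mul_sum_card_unmarked [Fintype ι] (U : Finset α) :
    2 * ∑ w, (unmarked idx w U).card = 2 ^ Fintype.card ι * U.card := by
  have h1 : ∀ u, 2 * ∑ w : ι → Bool, (if w (idx u) = false then 1 else 0) =
      2 ^ Fintype.card ι := by
    intro u
    rw [two_mul_sum_eq_sum_update (idx u)]
    simp
  simp_rw [unmarked, Finset.card_filter]
  rw [Finset.sum_comm, Finset.mul_sum]
  simp_rw [h1]
  simp [mul_comm]

end Coins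

/-! ### The greedy algorithm for two contracted matroids -/

section Greedy

variable {α : Type*} [DecidableEq α]

open Classical in
/-- Add `e` to `A` if `e ∉ T` and the result is still independent in both `M₁ ／ T` and `M₂ ／ S`. -/
noncomputable def greedyStep (M₁ M₂ : Matroid α) (T S A : Finset α) (e : α) : Finset α :=
  if e ∉ T ∧ M₁.Indep ((insert e (T ∪ A) : Finset α) : Set α) ∧
    M₂.Indep ((insert e (S ∪ A) : Finset α) : Set α) then insert e A else A

/-- Process the elements of `l` greedily, starting from `A`. -/
noncomputable def greedy (M₁ M₂ : Matroid α) (T S A : Finset α) (l : List α) : Finset α :=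
  l.foldl (greedyStep M₁ M₂ T S) A

variable {M₁ M₂ : Matroid α} {T S A : Finset α} {e : α} {l : List α}

@[simp]
lemma greedy_nil : greedy M₁ M₂ T S A [] = A := rfl

lemma greedy_cons :
    greedy M₁ M₂ T S A (e :: l) = greedy M₁ M₂ T S (greedyStep M₁ M₂ T S A e) l := rfl

lemma greedyStep_eq_or : greedyStep M₁ M₂ T S A e = A ∨ greedyStep M₁ M₂ T S A e = insert e A := by
  unfold greedyStep
  split_ifs <;> simp

lemma subset_greedyStep : A ⊆ greedyStep M₁ M₂ T S A e := by
  rcases greedyStep_eq_or (M₁ := M₁) (M₂ := M₂) (T := T) (S := S) (A := A) (e := e) with h | h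
  · exact h.ge
  · rw [h]
    exact Finset.subset_insert _ _

lemma greedy_spec (hd : Disjoint A T) (h₁ : M₁.Indep ((T ∪ A : Finset α) : Set α))
    (h₂ : M₂.Indep ((S ∪ A : Finset α) : Set α)) :
    A ⊆ greedy M₁ M₂ T S A l ∧ Disjoint (greedy M₁ M₂ T S A l) T ∧
      M₁.Indep ((T ∪ greedy M₁ M₂ T S A l : Finset α) : Set α) ∧
      M₂.Indep ((S ∪ greedy M₁ M₂ T S A l : Finset α) : Set α) := by
  induction l generalizing A with
  | nil => exact ⟨Finset.Subset.refl _, hd, h₁, h₂⟩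
  | cons e l ih =>
    rw [greedy_cons]
    suffices h : Disjoint (greedyStep M₁ M₂ T S A e) T ∧
        M₁.Indep ((T ∪ greedyStep M₁ M₂ T S A e : Finset α) : Set α) ∧
        M₂.Indep ((S ∪ greedyStep M₁ M₂ T S A e : Finset α) : Set α) by
      obtain ⟨ha, hb⟩ := ih h.1 h.2.1 h.2.2
      exact ⟨subset_greedyStep.trans ha, hb⟩
    unfold greedyStep
    split_ifs with h
    · rw [Finset.disjoint_insert_left, Finset.union_insert, Finset.union_insert]
      exact ⟨⟨h.1, hd⟩, h.2⟩
    · exact ⟨hd, h₁, h₂⟩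

/-- An element rejected when it was processed stays rejected, since the selected set only grows and
independence is hereditary. -/
lemma greedy_maximal (h₁ : M₁.Indep (A : Set α)) (h₂ : M₂.Indep (A : Set α)) :
    ∀ e ∈ l, e ∉ greedy M₁ M₂ ∅ ∅ A l →
      M₁.Indep ((insert e (greedy M₁ M₂ ∅ ∅ A l) : Finset α) : Set α) →
      ¬ M₂.Indep ((insert e (greedy M₁ M₂ ∅ ∅ A l) : Finset α) : Set α) := by
  induction l generalizing A with
  | nil => simp
  | cons a l ih =>
    intro e he
    have hs := greedy_spec (M₁ := M₁) (M₂ := M₂) (T := ∅) (S := ∅) (A := A) (l := [a])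
      (by simp) (by simpa using h₁) (by simpa using h₂)
    have hs' := greedy_spec (M₁ := M₁) (M₂ := M₂) (T := ∅) (S := ∅)
      (A := greedyStep M₁ M₂ ∅ ∅ A a) (l := l) hs.2.1 hs.2.2.1 hs.2.2.2
    rw [greedy_cons]
    rcases List.mem_cons.1 he with rfl | he
    · intro hn hi₁ hi₂
      have hsub : insert e A ⊆ insert e (greedy M₁ M₂ ∅ ∅ (greedyStep M₁ M₂ ∅ ∅ A e) l) :=
        Finset.insert_subset_insert _ (subset_greedyStep.trans hs'.1)
      apply hn
      apply hs'.1
      unfold greedyStep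
      rw [if_pos]
      · simp
      · refine ⟨by simp, ?_, ?_⟩
        · exact hi₁.subset (by rw [Finset.empty_union]; exact_mod_cast hsub)
        · exact hi₂.subset (by rw [Finset.empty_union]; exact_mod_cast hsub)
    · refine ih ?_ ?_ e he
      · simpa [greedy_cons] using hs.2.2.1
      · simpa [greedy_cons] using hs.2.2.2

variable {ι : Type*} [Fintype ι] [DecidableEq ι] {idx : α → ι}

/-- If a fair coin decides for every element of `U` whether it is contracted in `M₂`, then the
greedy algorithm selects on average at least a third of any set that could be added to `A` with
all of `U` left out. -/
theorem card_le_three_mul_sum_card_greedy (hidx : Function.Injective idx) (l : List α)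
    (U K A I : Finset α) (hIl : ∀ x ∈ I, x ∈ l)
    (hKUA : M₂.Indep ((K ∪ A ∪ U : Finset α) : Set α))
    (hIT : Disjoint I (T ∪ A)) (h₁ : M₁.Indep ((T ∪ A ∪ I : Finset α) : Set α))
    (hIK : Disjoint I (K ∪ A)) (h₂ : M₂.Indep ((K ∪ A ∪ I : Finset α) : Set α)) :
    2 ^ Fintype.card ι * (I.card + 3 * A.card) ≤
      3 * ∑ w, (greedy M₁ M₂ T (K ∪ unmarked idx w U) A l).card := by
  induction l generalizing U K A I with
  | nil =>
    have : I = ∅ := Finset.eq_empty_of_forall_notMem fun x hx => by simpa using hIl x hx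
    simp [this]
    exact le_of_eq (by ring)
  | cons e l ih =>
    -- Revealing a coin shrinks `U` but leaves the list unchanged, hence an inner induction on
    -- `|U|`.
    induction hk : U.card using Nat.strong_induction_on generalizing U K I with
    | _ k ihU =>
    -- Here `e` is rejected, or already selected, regardless of the coins, and it is not in `I`.
    by_cases hrej : e ∈ T ∨ e ∈ A ∨ ¬ M₁.Indep ((insert e (T ∪ A) : Finset α) : Set α)
    · have heI : e ∉ I := fun he => by
        have hd := Finset.disjoint_left.1 hIT he
        simp only [Finset.mem_union, not_or] at hd
        refine (hrej.resolve_left hd.1).resolve_left hd.2 (h₁.subset ?_)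
        rw [Finset.coe_subset]
        exact Finset.insert_subset (Finset.mem_union_right _ he) Finset.subset_union_left
      have hst : ∀ S, greedyStep M₁ M₂ T S A e = A := fun S => by
        unfold greedyStep
        split_ifs with h
        · exact Finset.insert_eq_self.2 ((hrej.resolve_left h.1).resolve_right (not_not.2 h.2.1))
        · rfl
      simp_rw [greedy_cons, hst]
      refine ih U K A I (fun x hx => ?_) hKUA hIT h₁ hIK h₂
      exact (List.mem_cons.1 (hIl x hx)).resolve_left fun h => heI (h ▸ hx)
    push Not at hrej
    obtain ⟨heT, heA, he₁⟩ := hrej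
    -- If `e` is acceptable even with all of `U'` contracted, every outcome accepts it. `I` loses at
    -- most one element per matroid and `3 * A.card` grows by three, which leaves the surplus of
    -- one.
    have haccept : ∀ (U' : Finset α), M₂.Indep ((insert e (K ∪ A ∪ U') : Finset α) : Set α) →
        2 ^ Fintype.card ι * (I.card + 1 + 3 * A.card) ≤
          3 * ∑ w, (greedy M₁ M₂ T (K ∪ unmarked idx w U') A (e :: l)).card := by
      intro U' hU'
      have hst : ∀ w, greedyStep M₁ M₂ T (K ∪ unmarked idx w U') A e = insert e A := by
        intro w
        refine if_pos ⟨heT, he₁, hU'.subset ?_⟩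
        rw [Finset.coe_subset]
        refine Finset.insert_subset_insert _ ?_
        intro x
        simp only [unmarked, Finset.mem_union, Finset.mem_filter]
        tauto
      simp_rw [greedy_cons, hst]
      obtain ⟨J₁, hJ₁, hd₁, hi₁, hc₁⟩ := exists_exchange h₁ hIT he₁
      obtain ⟨J₂, hJ₂, hd₂, hi₂, hc₂⟩ := exists_exchange (e := e) h₂ hIK
        (hU'.subset (by
          rw [Finset.coe_subset]
          exact Finset.insert_subset_insert _ Finset.subset_union_left))
      have hc : I.card ≤ (J₁ ∩ J₂).card + 2 := by
        have h3 := Finset.card_union_add_card_inter J₁ J₂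
        have h4 := Finset.card_le_card (Finset.union_subset hJ₁ hJ₂)
        omega
      have hle := ih U' K (insert e A) (J₁ ∩ J₂) (fun x hx => ?_) ?_ ?_ ?_ ?_ ?_
      · refine le_trans (Nat.mul_le_mul_left _ ?_) hle
        rw [Finset.card_insert_of_notMem heA]
        omega
      · rw [Finset.mem_inter] at hx
        refine (List.mem_cons.1 (hIl x (hJ₁ hx.1))).resolve_left fun h => ?_
        exact Finset.disjoint_left.1 hd₁ hx.1 (by simp [h])
      · rwa [Finset.union_insert, Finset.insert_union]
      · rw [Finset.union_insert]
        exact hd₁.mono_left Finset.inter_subset_left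
      · rw [Finset.union_insert]
        refine hi₁.subset ?_
        rw [Finset.coe_subset]
        exact Finset.union_subset_union_right Finset.inter_subset_left
      · rw [Finset.union_insert]
        exact hd₂.mono_left Finset.inter_subset_right
      · rw [Finset.union_insert]
        refine hi₂.subset ?_
        rw [Finset.coe_subset]
        exact Finset.union_subset_union_right Finset.inter_subset_right
    -- If `K ∪ A` already spans `e` in `M₂`, every outcome rejects `e`, and `e ∉ I`.
    by_cases hspan : M₂.Indep ((insert e (K ∪ A) : Finset α) : Set α)
    swap
    · have heI : e ∉ I := fun he => hspan (h₂.subset (by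
        rw [Finset.coe_subset]
        exact Finset.insert_subset (Finset.mem_union_right _ he) Finset.subset_union_left))
      have hst : ∀ w, greedyStep M₁ M₂ T (K ∪ unmarked idx w U) A e = A := fun w => by
        refine if_neg fun h => hspan (h.2.2.subset ?_)
        rw [Finset.coe_subset]
        exact Finset.insert_subset_insert _
          (Finset.union_subset_union_left Finset.subset_union_left)
      simp_rw [greedy_cons, hst]
      refine ih U K A I (fun x hx => ?_) hKUA hIT h₁ hIK h₂
      exact (List.mem_cons.1 (hIl x hx)).resolve_left fun h => heI (h ▸ hx)
    by_cases hfree : M₂.Indep ((insert e (K ∪ A ∪ U) : Finset α) : Set α)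
    · exact le_trans (Nat.mul_le_mul_left _ (by omega)) (haccept U hfree)
    -- Now the coins matter. If `t` is marked, `e` is accepted whatever the other coins show, with
    -- surplus one; if not, `t` joins `K` and `I` loses at most one element. The two outcomes
    -- balance.
    obtain ⟨t, htU, htX, ht⟩ := exists_erase_indep hKUA hspan hfree
    have htrue := haccept (U.erase t) ht
    obtain ⟨J, hJ, hd, hi, hc⟩ := exists_exchange (e := t) h₂ hIK (hKUA.subset (by
      rw [Finset.coe_subset]
      exact Finset.insert_subset (Finset.mem_union_right _ htU) Finset.subset_union_left))
    have hlt : (U.erase t).card < k := hk ▸ Finset.card_erase_lt_of_mem htU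
    have hfalse := ihU _ hlt (U.erase t) (insert t K) J (fun x hx => hIl x (hJ hx)) ?_
      (hIT.mono_left hJ) ?_ ?_ ?_ rfl
    · have hsplit := two_mul_sum_eq_sum_update (idx t)
        fun w => (greedy M₁ M₂ T (K ∪ unmarked idx w U) A (e :: l)).card
      simp only [unmarked_update_true hidx, unmarked_update_false hidx _ htU,
        Finset.union_insert] at hsplit
      simp only [Finset.insert_union] at hfalse
      have h5 : 2 ^ Fintype.card ι * (I.card + 3 * A.card) * 2 ≤
          2 ^ Fintype.card ι * (I.card + 1 + 3 * A.card) +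
            2 ^ Fintype.card ι * (J.card + 3 * A.card) := by
        rw [← mul_add, mul_assoc]
        exact Nat.mul_le_mul_left _ (by omega)
      omega
    · refine hKUA.subset ?_
      rw [Finset.coe_subset]
      intro x
      simp only [Finset.mem_union, Finset.mem_insert, Finset.mem_erase]
      rintro (((rfl | h) | h) | h) <;> tauto
    · refine h₁.subset ?_
      rw [Finset.coe_subset]
      exact Finset.union_subset_union_right hJ
    · rwa [Finset.insert_union]
    · rwa [Finset.insert_union]

end Greedy

/-! ### Combining two greedy passes, and the expected gain -/

section Swap

variable {α : Type*} [DecidableEq α] {M₁ M₂ : Matroid α} {T S : Finset α} {l : List α}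

/-- Two greedy passes add elements to `S ⊆ T`, each of them treating the elements of `T \ S` as
available in one of the two matroids only. -/
noncomputable def swapped (M₁ M₂ : Matroid α) (T S : Finset α) (l : List α) : Finset α :=
  S ∪ greedy M₁ M₂ T S ∅ l ∪ greedy M₂ M₁ T S ∅ l

lemma greedy_contract_spec (h₁ : M₁.Indep (T : Set α)) (h₂ : M₂.Indep (T : Set α)) (hST : S ⊆ T) :
    Disjoint (greedy M₁ M₂ T S ∅ l) T ∧
      M₁.Indep ((T ∪ greedy M₁ M₂ T S ∅ l : Finset α) : Set α) ∧
      M₂.Indep ((S ∪ greedy M₁ M₂ T S ∅ l : Finset α) : Set α) ∧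
      ∀ x ∈ greedy M₁ M₂ T S ∅ l, M₁.Indep ((insert x T : Finset α) : Set α) := by
  obtain ⟨-, hd, hi₁, hi₂⟩ := greedy_spec (M₁ := M₁) (M₂ := M₂) (T := T) (S := S) (A := ∅)
    (l := l) (by simp) (by simpa using h₁)
    (by rw [Finset.union_empty]; exact h₂.subset (by exact_mod_cast hST))
  refine ⟨hd, hi₁, hi₂, fun x hx => hi₁.subset ?_⟩
  rw [Finset.coe_subset]
  exact Finset.insert_subset (Finset.mem_union_right _ hx) Finset.subset_union_left

/-- An element of `S ∪ A` outside `T` lies in `A`, so it extends `T` in `M₁` and, by maximality, is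
spanned by `T` in `M₂`. Hence `T` can be exchanged for `S ∪ A` beside `B`. -/
lemma swapped_indep_right (h₁ : M₁.Indep (T : Set α)) (h₂ : M₂.Indep (T : Set α))
    (hmax : ∀ e, e ∉ T → M₁.Indep ((insert e T : Finset α) : Set α) →
      ¬ M₂.Indep ((insert e T : Finset α) : Set α)) (hST : S ⊆ T) :
    M₂.Indep (swapped M₁ M₂ T S l : Set α) := by
  obtain ⟨-, -, hiA, hA⟩ := greedy_contract_spec (l := l) h₁ h₂ hST
  obtain ⟨hdB, hiB, -, -⟩ := greedy_contract_spec (l := l) h₂ h₁ hST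
  refine indep_union_of_spanned hiB hdB.symm hiA fun x hx hxT => hmax x hxT (hA x ?_)
  exact (Finset.mem_union.1 hx).resolve_left fun h => hxT (hST h)

lemma swapped_comm : swapped M₁ M₂ T S l = swapped M₂ M₁ T S l := by
  unfold swapped
  rw [Finset.union_assoc, Finset.union_comm (greedy _ _ _ _ _ _), Finset.union_assoc]

lemma swapped_indep_left (h₁ : M₁.Indep (T : Set α)) (h₂ : M₂.Indep (T : Set α))
    (hmax : ∀ e, e ∉ T → M₁.Indep ((insert e T : Finset α) : Set α) →
      ¬ M₂.Indep ((insert e T : Finset α) : Set α)) (hST : S ⊆ T) :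
    M₁.Indep (swapped M₁ M₂ T S l : Set α) := by
  rw [swapped_comm]
  exact swapped_indep_right h₂ h₁ (fun e he hi₂ hi₁ => hmax e he hi₁ hi₂) hST

/-- The two passes cannot select the same element: it would extend `T` in both matroids. -/
lemma card_swapped (h₁ : M₁.Indep (T : Set α)) (h₂ : M₂.Indep (T : Set α))
    (hmax : ∀ e, e ∉ T → M₁.Indep ((insert e T : Finset α) : Set α) →
      ¬ M₂.Indep ((insert e T : Finset α) : Set α)) (hST : S ⊆ T) :
    (swapped M₁ M₂ T S l).card =
      S.card + (greedy M₁ M₂ T S ∅ l).card + (greedy M₂ M₁ T S ∅ l).card := by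
  obtain ⟨hdA, -, -, hA⟩ := greedy_contract_spec (l := l) h₁ h₂ hST
  obtain ⟨hdB, -, -, hB⟩ := greedy_contract_spec (l := l) h₂ h₁ hST
  rw [swapped, Finset.card_union_of_disjoint, Finset.card_union_of_disjoint]
  · exact (hdA.mono_right hST).symm
  · rw [Finset.disjoint_union_left]
    refine ⟨(hdB.mono_right hST).symm, Finset.disjoint_left.2 fun x hxA hxB => ?_⟩
    exact hmax x (Finset.disjoint_left.1 hdA hxA) (hA x hxA) (hB x hxB)

variable {ι : Type*} [Fintype ι] [DecidableEq ι] {idx : α → ι}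

/-- The part of `O` that augments `T` in `M₁` serves as the initial solution `I`. It is independent
in `M₂` with nothing contracted, so `K = ∅`, and all of `T` is still undecided, so `U = T`. -/
lemma card_le_card_add_three_mul_sum (hidx : Function.Injective idx) {O : Finset α}
    (h₁ : M₁.Indep (T : Set α)) (h₂ : M₂.Indep (T : Set α))
    (hO₁ : M₁.Indep (O : Set α)) (hO₂ : M₂.Indep (O : Set α)) (hl : ∀ e, e ∈ l) :
    2 ^ Fintype.card ι * O.card ≤ 2 ^ Fintype.card ι * T.card +
      3 * ∑ w, (greedy M₁ M₂ T (unmarked idx w T) ∅ l).card := by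
  obtain ⟨I, hIsub, hd, hi, hc⟩ := exists_augmentation O hO₁ T h₁
  have h := card_le_three_mul_sum_card_greedy (M₁ := M₁) (M₂ := M₂) (T := T) hidx l T ∅ ∅ I
    (fun x _ => hl x) (by simpa using h₂) (by simpa using hd)
    (by rwa [Finset.union_empty]) (by simp)
    (by rw [Finset.empty_union, Finset.empty_union]; exact hO₂.subset (by exact_mod_cast hIsub))
  simp only [Finset.empty_union, Finset.card_empty, mul_zero, add_zero] at h
  calc 2 ^ Fintype.card ι * O.card ≤ 2 ^ Fintype.card ι * (T.card + I.card) :=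
        Nat.mul_le_mul_left _ hc
    _ ≤ _ := by rw [mul_add]; exact Nat.add_le_add_left h _

/-- A common independent set that is maximal has at least half the maximum size. -/
lemma card_le_two_mul_card {O : Finset α} (h₁ : M₁.Indep (T : Set α)) (h₂ : M₂.Indep (T : Set α))
    (hmax : ∀ e, e ∉ T → M₁.Indep ((insert e T : Finset α) : Set α) →
      ¬ M₂.Indep ((insert e T : Finset α) : Set α))
    (hO₁ : M₁.Indep (O : Set α)) (hO₂ : M₂.Indep (O : Set α)) : O.card ≤ 2 * T.card := by
  obtain ⟨I, hIsub, hd, hi, hc⟩ := exists_augmentation O hO₁ T h₁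
  have h := card_le_of_forall_not_indep h₂ (hO₂.subset (by exact_mod_cast hIsub))
    fun x hx hxT => hmax x hxT (hi.subset (by
      rw [Finset.coe_subset]
      exact Finset.insert_subset (Finset.mem_union_right _ hx) Finset.subset_union_left))
  omega

/-- The expected size of the result, if `S` is `T` or a uniformly random subset of `T`, depending
on a further fair coin `j`. -/
theorem card_le_sum_card_swapped (hidx : Function.Injective idx) {j : ι} (hj : ∀ u, idx u ≠ j)
    {O : Finset α} (h₁ : M₁.Indep (T : Set α)) (h₂ : M₂.Indep (T : Set α))
    (hmax : ∀ e, e ∉ T → M₁.Indep ((insert e T : Finset α) : Set α) →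
      ¬ M₂.Indep ((insert e T : Finset α) : Set α))
    (hO₁ : M₁.Indep (O : Set α)) (hO₂ : M₂.Indep (O : Set α)) (hl : ∀ e, e ∈ l) :
    13 * (2 ^ Fintype.card ι * O.card) ≤
      24 * ∑ w, (swapped M₁ M₂ T (if w j then unmarked idx w T else T) l).card := by
  rw [show 24 = 12 * 2 from rfl, mul_assoc, two_mul_sum_eq_sum_update j]
  simp only [Function.update_self, if_true, unmarked_update_of_notMem_range hj,
    Bool.false_eq_true, if_false]
  have hsub : ∀ w, unmarked idx w T ⊆ T := fun w => Finset.filter_subset _ _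
  simp only [card_swapped h₁ h₂ hmax (hsub _), card_swapped h₁ h₂ hmax (Finset.Subset.refl T),
    Finset.sum_add_distrib]
  have hA := card_le_card_add_three_mul_sum hidx h₁ h₂ hO₁ hO₂ hl
  have hB := card_le_card_add_three_mul_sum hidx h₂ h₁ hO₂ hO₁ hl
  have hT := two_mul_sum_card_unmarked (idx := idx) T
  have hS : ∑ w : ι → Bool, T.card = 2 ^ Fintype.card ι * T.card := by simp
  have hh := Nat.mul_le_mul_left (2 ^ Fintype.card ι)
    (card_le_two_mul_card h₁ h₂ hmax hO₁ hO₂)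
  rw [mul_left_comm] at hh
  -- Per outcome of the remaining coins, the two values of `j` contribute on average at least `|T|/2
  -- + 2(|O| - |T|)/3` and `|T|`. Their sum `2|O|/3 + 5|T|/6` is at least `13|O|/12`, as `|O| ≤
  -- 2|T|`.
  omega

end Swap

/-! ### Reasoning about programs -/

section Semantics

variable {n : ℕ} {O : Fin 2 → Finset (Fin n) → Bool} {ω : ℕ → Bool}

/-- Starting in `s`, the command `c` terminates in `s'` after at most `k` steps. -/
def Runs (O : Fin 2 → Finset (Fin n) → Bool) (ω : ℕ → Bool) (c : Cmd) (s : State) (k : ℕ)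
    (s' : State) : Prop :=
  ∃ j ≤ k, ∀ K, (step O ω)^[j] (c :: K, s) = (K, s')

lemma Runs.mono {c : Cmd} {s s' : State} {k l : ℕ} (h : Runs O ω c s k s') (hkl : k ≤ l) :
    Runs O ω c s l s' :=
  let ⟨j, hj, hr⟩ := h
  ⟨j, hj.trans hkl, hr⟩

lemma Runs.of_step {c d : Cmd} {s s' : State} {k : ℕ}
    (hs : ∀ K, step O ω (c :: K, s) = (d :: K, s)) (h : Runs O ω d s k s') :
    Runs O ω c s (k + 1) s' := by
  obtain ⟨j, hj, hr⟩ := h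
  exact ⟨j + 1, by omega, fun K => by rw [Function.iterate_succ_apply, hs, hr]⟩

lemma Runs.seq {c d : Cmd} {s s₁ s₂ : State} {k l : ℕ} (hc : Runs O ω c s k s₁)
    (hd : Runs O ω d s₁ l s₂) : Runs O ω (.seq c d) s (k + l + 1) s₂ := by
  obtain ⟨i, hi, hi'⟩ := hc
  obtain ⟨j, hj, hj'⟩ := hd
  refine ⟨j + i + 1, by omega, fun K => ?_⟩
  rw [Function.iterate_succ_apply, Function.iterate_add_apply]
  exact (congrArg _ (hi' (d :: K))).trans (hj' K)

lemma Runs.ite {x : ℕ} {c d : Cmd} {s s' : State} {k : ℕ}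
    (h : Runs O ω (if s.var x ≠ 0 then c else d) s k s') : Runs O ω (.ite x c d) s (k + 1) s' :=
  h.of_step fun _ => rfl

lemma Runs.loop_zero {x : ℕ} {c : Cmd} {s : State} (h : s.var x = 0) :
    Runs O ω (.loop x c) s 1 s :=
  ⟨1, le_rfl, fun K => by simp [step, h]⟩

lemma Runs.loop_succ {x : ℕ} {c : Cmd} {s s₁ s₂ : State} {k l : ℕ} (h : s.var x ≠ 0)
    (hc : Runs O ω c s k s₁) (hd : Runs O ω (.loop x c) s₁ l s₂) :
    Runs O ω (.loop x c) s (k + l + 1) s₂ := by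
  obtain ⟨i, hi, hi'⟩ := hc
  obtain ⟨j, hj, hj'⟩ := hd
  refine ⟨j + i + 1, by omega, fun K => ?_⟩
  rw [Function.iterate_succ_apply, Function.iterate_add_apply]
  have : step O ω (Cmd.loop x c :: K, s) = (c :: Cmd.loop x c :: K, s) := by simp [step, h]
  rw [this, hi', hj']

lemma Runs.run_eq {P : Cmd} {s : State} {k t : ℕ} (h : Runs O ω P (State.init n) k s)
    (hkt : k ≤ t) : run P O ω t = ([], s) := by
  obtain ⟨j, hj, hr⟩ := h
  obtain ⟨i, rfl⟩ := Nat.exists_eq_add_of_le (hj.trans hkt)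
  rw [run, add_comm, Function.iterate_add_apply, hr]
  exact Function.iterate_fixed rfl i

/-- No loop occurs in the command. -/
def Cmd.LoopFree : Cmd → Prop
  | .seq c d => c.LoopFree ∧ d.LoopFree
  | .ite _ c d => c.LoopFree ∧ d.LoopFree
  | .loop _ _ => False
  | _ => True

/-- A bound on the running time of a loop-free command. -/
def Cmd.size : Cmd → ℕ
  | .seq c d => c.size + d.size + 1
  | .ite _ c d => c.size + d.size + 1
  | _ => 1

/-- The effect of a loop-free command. -/
def Cmd.eval (O : Fin 2 → Finset (Fin n) → Bool) (ω : ℕ → Bool) : Cmd → State → State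
  | .seq c d, s => d.eval O ω (c.eval O ω s)
  | .ite x c d, s => if s.var x ≠ 0 then c.eval O ω s else d.eval O ω s
  | c, s => (step O ω ([c], s)).2

lemma Cmd.LoopFree.runs {c : Cmd} (hc : c.LoopFree) (s : State) :
    Runs O ω c s c.size (c.eval O ω s) := by
  induction c generalizing s with
  | seq c d ihc ihd => exact (ihc hc.1 s).seq (ihd hc.2 _)
  | ite x c d ihc ihd =>
    by_cases h : s.var x ≠ 0
    · have := Runs.ite (x := x) (c := c) (d := d) (s := s)
        (by rw [if_pos h]; exact ihc hc.1 s)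
      rw [Cmd.eval, if_pos h]
      exact this.mono (by simp [Cmd.size])
    · have := Runs.ite (x := x) (c := c) (d := d) (s := s)
        (by rw [if_neg h]; exact ihd hc.2 s)
      rw [Cmd.eval, if_neg h]
      exact this.mono (by simp [Cmd.size])
  | loop x c => exact hc.elim
  | _ => exact ⟨1, le_rfl, fun K => rfl⟩

/-- Run `c` with variable `1` going through `0, …, n - 1`. -/
def forEach (c : Cmd) : Cmd :=
  .seq (.copy 2 0) (.seq (.const 1 0) (.loop 2 (.seq c (.seq (.succ 1) (.pred 2)))))

/-- The invariant rule for `forEach`. -/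
lemma runs_forEach {β : Type*} {c : Cmd} {k : ℕ} (f : β → Fin n → β) (R : ℕ → β → State → Prop)
    (hR : ∀ i b s s', R i b s → s'.arr = s.arr → s'.coins = s.coins → s'.queries = s.queries →
      (∀ x, x ≠ 1 → x ≠ 2 → s'.var x = s.var x) → R i b s')
    (hc : ∀ (e : Fin n) b s, R e b s → s.var 1 = e →
      ∃ s', Runs O ω c s k s' ∧ R (e + 1) (f b e) s' ∧ s'.var 1 = s.var 1 ∧ s'.var 2 = s.var 2)
    {b : β} {s : State} (hn : s.var 0 = n) (h : R 0 b s) :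
    ∃ s', Runs O ω (forEach c) s ((k + 5) * n + 5) s' ∧ R n ((List.finRange n).foldl f b) s' := by
  have hloop : ∀ (m i : ℕ) (b : β) (s : State), i + m = n → s.var 1 = i → s.var 2 = m → R i b s →
      ∃ s', Runs O ω (.loop 2 (.seq c (.seq (.succ 1) (.pred 2)))) s ((k + 5) * m + 1) s' ∧
        R n (((List.finRange n).drop i).foldl f b) s' := by
    intro m
    induction m with
    | zero =>
      intro i b s hi _ h2 hr
      refine ⟨s, (Runs.loop_zero h2).mono (by omega), ?_⟩
      rw [List.drop_eq_nil_of_le (by simp; omega)]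
      obtain rfl : i = n := by omega
      exact hr
    | succ m ih =>
      intro i b s hi h1 h2 hr
      have hin : i < n := by omega
      obtain ⟨s₁, hrun, hr₁, hv1, hv2⟩ := hc ⟨i, hin⟩ b s hr h1
      have hinc := Cmd.LoopFree.runs (O := O) (ω := ω) (c := .seq (.succ 1) (.pred 2))
        (by simp [Cmd.LoopFree]) s₁
      obtain ⟨s', hs', hr'⟩ := ih (i + 1) (f b ⟨i, hin⟩)
        (Cmd.eval O ω (.seq (.succ 1) (.pred 2)) s₁) (by omega)
        (by simp [Cmd.eval, step, State.set, hv1, h1]) (by simp [Cmd.eval, step, State.set, hv2, h2])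
        (hR _ _ _ _ hr₁ rfl rfl rfl fun x hx1 hx2 => by
          simp [Cmd.eval, step, State.set, hx1, hx2])
      -- One round costs `k` for `c`, 3 for the two counter updates, and one step each for the
      -- sequencing and the loop test.
      refine ⟨s', ((hrun.seq hinc).loop_succ (by omega) hs').mono ?_, ?_⟩
      · simp only [Cmd.size, mul_add]
        omega
      · rw [List.drop_eq_getElem_cons (by simpa using hin)]
        simpa using hr'
  have hinit := Cmd.LoopFree.runs (O := O) (ω := ω) (c := .copy 2 0) (by simp [Cmd.LoopFree]) s
  have hinit' := Cmd.LoopFree.runs (O := O) (ω := ω) (c := .const 1 0) (by simp [Cmd.LoopFree])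
    (Cmd.eval O ω (.copy 2 0) s)
  obtain ⟨s', hs', hr'⟩ := hloop n 0 b
    (Cmd.eval O ω (.const 1 0) (Cmd.eval O ω (.copy 2 0) s)) (by omega)
    (by simp [Cmd.eval, step, State.set]) (by simp [Cmd.eval, step, State.set, hn])
    (hR _ _ _ _ h rfl rfl rfl fun x hx1 hx2 => by
      simp [Cmd.eval, step, State.set, hx1, hx2])
  exact ⟨s', (hinit.seq (hinit'.seq hs')).mono (by simp only [Cmd.size]; omega), by simpa using hr'⟩

end Semantics

/-! ### The program -/

section Program

/-- One greedy step on the element in variable `1`, unless it lies in the set in array `t`. -/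
def sweepBody (i : Fin 2) (t a b : ℕ) : Cmd :=
  .seq (.load 3 t 1) (.ite 3 .skip
    (.seq (.store a 1 5) (.seq (.store b 1 5) (.seq (.query i 6 a) (.seq (.query (1 - i) 7 b)
      (.ite 6 (.ite 7 (.store 0 1 5) (.seq (.store a 1 8) (.store b 1 8)))
        (.seq (.store a 1 8) (.store b 1 8))))))))

/-- Copy an element of the greedy solution in array `1` to array `4`, and, unless it gets marked,
to the arrays `3` and `5`; marked elements are removed from the output. -/
def markBody : Cmd :=
  .seq (.toss 3) (.seq (.load 6 1 1) (.ite 6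
    (.seq (.store 4 1 5) (.ite 3 (.ite 4 (.store 0 1 8) (.seq (.store 3 1 5) (.store 5 1 5)))
      (.seq (.store 3 1 5) (.store 5 1 5)))) .skip))

/-- Compute a greedy solution, remove a random part of it, and make the two kinds of swaps. -/
def program : Cmd :=
  .seq (.seq (.const 5 1) (.toss 4)) (.seq (forEach (sweepBody 0 6 1 2)) (.seq (forEach markBody)
    (.seq (forEach (sweepBody 0 1 2 3)) (forEach (sweepBody 1 1 4 5)))))

variable {n : ℕ}

/-- The set whose indicator is `f`. -/
def support (n : ℕ) (f : ℕ → ℕ) : Finset (Fin n) :=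
  Finset.univ.filter fun e : Fin n => f e ≠ 0

lemma toSet_eq_support (s : State) (a : ℕ) : s.toSet n a = support n (s.arr a) := rfl

lemma mem_support {f : ℕ → ℕ} {e : Fin n} : e ∈ support n f ↔ f e ≠ 0 := by simp [support]

lemma support_update_one (f : ℕ → ℕ) (e : Fin n) :
    support n (Function.update f e 1) = insert e (support n f) := by
  ext x
  by_cases h : x = e
  · simp [mem_support, h]
  · have : (x : ℕ) ≠ e := fun h' => h (Fin.ext h')
    simp [mem_support, h, this]

lemma support_update_zero (f : ℕ → ℕ) (e : Fin n) :
    support n (Function.update f e 0) = (support n f).erase e := by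
  ext x
  by_cases h : x = e
  · simp [mem_support, h]
  · have : (x : ℕ) ≠ e := fun h' => h (Fin.ext h')
    simp [mem_support, h, this]

@[simp]
lemma support_zero : support n (fun _ => 0) = ∅ := by simp [support]

lemma notMem_of_forall_lt {A : Finset (Fin n)} {e : Fin n} (h : ∀ x ∈ A, (x : ℕ) < e) : e ∉ A :=
  fun he => (h e he).false

/-- The constants and the coin that the program keeps in its variables. -/
structure Registers (n c : ℕ) (s : State) : Prop where
  size : s.var 0 = n
  coin : s.var 4 = c
  one : s.var 5 = 1
  zero : s.var 8 = 0

lemma Registers.of_var {c : ℕ} {s s' : State} (h : Registers n c s)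
    (hv : ∀ x, x ≠ 1 → x ≠ 2 → s'.var x = s.var x) : Registers n c s' where
  size := by rw [hv 0 (by decide) (by decide), h.size]
  coin := by rw [hv 4 (by decide) (by decide), h.coin]
  one := by rw [hv 5 (by decide) (by decide), h.one]
  zero := by rw [hv 8 (by decide) (by decide), h.zero]

variable {M : Fin 2 → Matroid (Fin n)} {ω : ℕ → Bool} {c : ℕ}

lemma indepOracle_iff {i : Fin 2} {X : Finset (Fin n)} :
    indepOracle M i X = true ↔ (M i).Indep (X : Set (Fin n)) := by
  simp [indepOracle]

/-- The state after `j` steps of a sweep that started in `s₀` and has selected `A`. -/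
structure SweepInv (c a b : ℕ) (s₀ : State) (T S W : Finset (Fin n)) (j : ℕ)
    (A : Finset (Fin n)) (s : State) : Prop where
  regs : Registers n c s
  coins : s.coins = s₀.coins
  queries : s.queries ≤ s₀.queries + 2 * j
  first : support n (s.arr a) = T ∪ A
  second : support n (s.arr b) = S ∪ A
  out : support n (s.arr 0) = W ∪ A
  frame : ∀ x, x ≠ a → x ≠ b → x ≠ 0 → s.arr x = s₀.arr x
  lt : ∀ x ∈ A, (x : ℕ) < j

lemma sweepBody_spec {i : Fin 2} {t a b : ℕ} (hta : t ≠ a) (htb : t ≠ b) (ht : t ≠ 0)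
    (hab : a ≠ b) (ha : a ≠ 0) (hb : b ≠ 0) {s₀ : State} {T S W : Finset (Fin n)} (hST : S ⊆ T)
    (hT : support n (s₀.arr t) = T) (e : Fin n) (A : Finset (Fin n)) (s : State)
    (h : SweepInv c a b s₀ T S W e A s) (h1 : s.var 1 = e) :
    ∃ s', Runs (indepOracle M) ω (sweepBody i t a b) s 21 s' ∧
      SweepInv c a b s₀ T S W (e + 1) (greedyStep (M i) (M (1 - i)) T S A e) s' ∧
      s'.var 1 = s.var 1 ∧ s'.var 2 = s.var 2 := by
  obtain ⟨⟨r0, r4, r5, r8⟩, hco, hq, hfi, hse, hou, hfr, hlt⟩ := h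
  have heA := notMem_of_forall_lt hlt
  have hlt' : ∀ x ∈ A, (x : ℕ) < e + 1 := fun x hx => (hlt x hx).trans (Nat.lt_succ_self _)
  refine ⟨_, (Cmd.LoopFree.runs (by simp [sweepBody, Cmd.LoopFree]) s).mono
    (by simp [sweepBody, Cmd.size]), ?_⟩
  by_cases heT : e ∈ T
  · have hl : s.arr t e ≠ 0 := by rwa [hfr t hta htb ht, ← mem_support, hT]
    have hst : greedyStep (M i) (M (1 - i)) T S A e = A := if_neg fun h => h.1 heT
    rw [hst]
    have hev : (sweepBody i t a b).eval (indepOracle M) ω s = s.set 3 (s.arr t e) := by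
      simp [sweepBody, Cmd.eval, step, State.set, h1, hl]
    rw [hev]
    refine ⟨⟨⟨r0, r4, r5, r8⟩, hco, hq.trans (by omega), hfi, hse, hou, hfr, hlt'⟩, rfl, rfl⟩
  have hl : s.arr t e = 0 := by
    rw [hfr t hta htb ht]
    by_contra h
    rw [← hT, mem_support] at heT
    exact heT h
  have heS : e ∉ S := fun h => heT (hST h)
  have hua : support n (Function.update (s.arr a) e 1) = insert e (T ∪ A) := by
    rw [support_update_one, hfi]
  have hub : support n (Function.update (s.arr b) e 1) = insert e (S ∪ A) := by
    rw [support_update_one, hse]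
  have hua' : support n (Function.update (s.arr a) e 0) = T ∪ A := by
    rw [support_update_zero, hfi]
    exact Finset.erase_eq_of_notMem (by simp [heT, heA])
  have hub' : support n (Function.update (s.arr b) e 0) = S ∪ A := by
    rw [support_update_zero, hse]
    exact Finset.erase_eq_of_notMem (by simp [heS, heA])
  have huo : support n (Function.update (s.arr 0) e 1) = insert e (W ∪ A) := by
    rw [support_update_one, hou]
  by_cases hacc : (M i).Indep ((insert e (T ∪ A) : Finset (Fin n)) : Set (Fin n)) ∧
    (M (1 - i)).Indep ((insert e (S ∪ A) : Finset (Fin n)) : Set (Fin n))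
  · have hst : greedyStep (M i) (M (1 - i)) T S A e = insert e A := if_pos ⟨heT, hacc⟩
    rw [hst]
    have hq₁ : indepOracle M i (insert e (T ∪ A)) = true := indepOracle_iff.2 hacc.1
    have hq₂ : indepOracle M (1 - i) (insert e (S ∪ A)) = true := indepOracle_iff.2 hacc.2
    generalize hs' : (sweepBody i t a b).eval (indepOracle M) ω s = s'
    simp [sweepBody, Cmd.eval, step, State.set, toSet_eq_support, h1, hl, r5,
      hab, hab.symm, ha.symm, hb.symm, hua, hub, hq₁, hq₂] at hs'
    subst hs'
    refine ⟨⟨⟨r0, r4, r5, r8⟩, hco, ?_, ?_, ?_, ?_, fun x hxa hxb hx0 => ?_, ?_⟩, ?_, ?_⟩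
    · simp only
      omega
    · simp [ha, hab, hua]
    · simp [hb, hub]
    · simp [huo]
    · simp [hxa, hxb, hx0, hfr x hxa hxb hx0]
    · rw [Finset.forall_mem_insert]
      exact ⟨Nat.lt_succ_self _, hlt'⟩
    · simp [h1]
    · simp
  · have hst : greedyStep (M i) (M (1 - i)) T S A e = A := if_neg fun h => hacc h.2
    rw [hst]
    have hq : indepOracle M i (insert e (T ∪ A)) = true →
        indepOracle M (1 - i) (insert e (S ∪ A)) = false := by
      intro h
      rw [Bool.eq_false_iff]
      exact fun h' => hacc ⟨indepOracle_iff.1 h, indepOracle_iff.1 h'⟩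
    generalize hs' : (sweepBody i t a b).eval (indepOracle M) ω s = s'
    -- Both ways to reject, after a negative first or second answer, undo the tentative insertions
    -- and differ only in scratch variables.
    suffices h : s'.arr = Function.update (Function.update s.arr a
        (Function.update (s.arr a) e 0)) b (Function.update (s.arr b) e 0) ∧
        s'.coins = s.coins ∧ s'.queries = s.queries + 2 ∧
        ∀ x, x ≠ 3 → x ≠ 6 → x ≠ 7 → s'.var x = s.var x by
      obtain ⟨harr, hcoins, hqueries, hvar⟩ := h
      refine ⟨⟨⟨?_, ?_, ?_, ?_⟩, ?_, ?_, ?_, ?_, ?_, fun x hxa hxb hx0 => ?_, hlt'⟩, ?_, ?_⟩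
      · rw [hvar 0 (by decide) (by decide) (by decide), r0]
      · rw [hvar 4 (by decide) (by decide) (by decide), r4]
      · rw [hvar 5 (by decide) (by decide) (by decide), r5]
      · rw [hvar 8 (by decide) (by decide) (by decide), r8]
      · rw [hcoins, hco]
      · omega
      · simp [harr, hab, hua']
      · simp [harr, hub']
      · simp [harr, ha.symm, hb.symm, hou]
      · simp [harr, hxa, hxb, hfr x hxa hxb hx0]
      · exact hvar 1 (by decide) (by decide) (by decide)
      · exact hvar 2 (by decide) (by decide) (by decide)
    have hcomm : ∀ f : ℕ → ℕ → ℕ, ∀ u v u' v', Function.update (Function.update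
        (Function.update (Function.update f a u) b v) a u') b v' =
        Function.update (Function.update f a u') b v' := by
      intro f u v u' v'
      rw [Function.update_comm hab.symm, Function.update_idem, Function.update_idem]
    cases hq₁ : indepOracle M i (insert e (T ∪ A)) with
    | false =>
      simp [sweepBody, Cmd.eval, step, State.set, toSet_eq_support, h1, hl, r5, r8,
        hab, hab.symm, hua, hub, hq₁, hcomm] at hs'
      subst hs'
      exact ⟨rfl, rfl, rfl, fun x h3 h6 h7 => by simp [h3, h6, h7]⟩
    | true =>
      simp [sweepBody, Cmd.eval, step, State.set, toSet_eq_support, h1, hl, r5, r8,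
        hab, hab.symm, hua, hub, hq₁, hq hq₁, hcomm] at hs'
      subst hs'
      exact ⟨rfl, rfl, rfl, fun x h3 h6 h7 => by simp [h3, h6, h7]⟩

/-- The effect of a sweep. -/
lemma sweep_spec {i : Fin 2} {t a b : ℕ} (hta : t ≠ a) (htb : t ≠ b) (ht : t ≠ 0)
    (hab : a ≠ b) (ha : a ≠ 0) (hb : b ≠ 0) {s : State} {T S W : Finset (Fin n)} (hST : S ⊆ T)
    (hr : Registers n c s) (hT : support n (s.arr t) = T) (hT' : support n (s.arr a) = T)
    (hS : support n (s.arr b) = S) (hW : support n (s.arr 0) = W) :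
    ∃ s', Runs (indepOracle M) ω (forEach (sweepBody i t a b)) s (26 * n + 5) s' ∧
      SweepInv c a b s T S W n (greedy (M i) (M (1 - i)) T S ∅ (List.finRange n)) s' := by
  refine runs_forEach (greedyStep (M i) (M (1 - i)) T S) (SweepInv c a b s T S W) ?_
    (fun e A s' => sweepBody_spec hta htb ht hab ha hb hST hT e A s') hr.size ?_
  · intro j A s₁ s₂ h harr hcoins hqueries hvar
    exact ⟨h.regs.of_var hvar, by rw [hcoins, h.coins], by rw [hqueries]; exact h.queries,
      by rw [harr, h.first], by rw [harr, h.second], by rw [harr, h.out],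
      by rw [harr]; exact h.frame, h.lt⟩
  · exact ⟨hr, rfl, le_rfl, by simpa using hT', by simpa using hS, by simpa using hW,
      fun _ _ _ _ => rfl, by simp⟩

/-- The element `e` stays if the first coin or its own coin shows `false`. -/
def Stays (ω : ℕ → Bool) (e : ℕ) : Prop :=
  ω 0 = false ∨ ω (e + 1) = false

instance (ω : ℕ → Bool) (e : ℕ) : Decidable (Stays ω e) :=
  inferInstanceAs (Decidable (_ ∨ _))

/-- The state after the coins of the elements smaller than `j` have been tossed. -/
structure MarkInv (ω : ℕ → Bool) (s₀ : State) (T : Finset (Fin n)) (j : ℕ) (s : State) :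
    Prop where
  regs : Registers n (if ω 0 then 1 else 0) s
  coins : s.coins = j + 1
  queries : s.queries = s₀.queries
  zero : ∀ x : Fin n, s.arr 0 x ≠ 0 ↔ x ∈ T ∧ ((x : ℕ) < j → Stays ω x)
  three : ∀ x : Fin n, s.arr 3 x ≠ 0 ↔ x ∈ T ∧ (x : ℕ) < j ∧ Stays ω x
  four : ∀ x : Fin n, s.arr 4 x ≠ 0 ↔ x ∈ T ∧ (x : ℕ) < j
  five : ∀ x : Fin n, s.arr 5 x ≠ 0 ↔ x ∈ T ∧ (x : ℕ) < j ∧ Stays ω x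
  one : s.arr 1 = s₀.arr 1
  two : s.arr 2 = s₀.arr 2

/-- A coin is tossed for every element, in `T` or not, so that the coin of `e` sits at position `e +
1` of the tape, after the coin that chooses the branch. -/
lemma markBody_spec {O : Fin 2 → Finset (Fin n) → Bool} {s₀ : State} {T : Finset (Fin n)}
    (hT : support n (s₀.arr 1) = T) (e : Fin n)
    (s : State) (h : MarkInv ω s₀ T e s) (h1 : s.var 1 = e) :
    ∃ s', Runs O ω markBody s 19 s' ∧ MarkInv ω s₀ T (e + 1) s' ∧
      s'.var 1 = s.var 1 ∧ s'.var 2 = s.var 2 := by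
  obtain ⟨⟨r0, r4, r5, r8⟩, hco, hq, h0, h3, h4, h5, hone, htwo⟩ := h
  refine ⟨_, (Cmd.LoopFree.runs (by simp [markBody, Cmd.LoopFree]) s).mono
    (by simp [markBody, Cmd.size]), ?_⟩
  have hl : s.arr 1 e ≠ 0 ↔ e ∈ T := by rw [hone, ← hT, mem_support]
  generalize hs' : markBody.eval O ω s = s'
  have hlt : ∀ x : Fin n, x ≠ e → ((x : ℕ) < e + 1 ↔ (x : ℕ) < e) := fun x hx => by
    have : (x : ℕ) ≠ e := fun h => hx (Fin.ext h)
    omega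
  have hval : ∀ x : Fin n, x ≠ e → (x : ℕ) ≠ e := fun x hx h => hx (Fin.ext h)
  by_cases heT : e ∈ T
  · have hl' : s.arr 1 e ≠ 0 := hl.2 heT
    cases hω : ω 0 <;> cases hωe : ω (e + 1) <;>
      simp only [hω, if_true, if_false, Bool.false_eq_true] at r4 <;>
    · simp [markBody, Cmd.eval, step, State.set, h1, hl', r4, r5, r8, hco, hωe] at hs'
      subst hs'
      refine ⟨⟨⟨?_, ?_, ?_, ?_⟩, ?_, ?_, ?_, ?_, ?_, ?_, ?_, ?_⟩, ?_, ?_⟩ <;>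
        try intro x
      all_goals first
        | simp [*]; done
        | by_cases hx : x = e
          · subst hx
            simp [*, Stays]
          · simp [*, hlt x hx, hval x hx]
  · have hl' : s.arr 1 e = 0 := by
      by_contra h
      exact heT (hl.1 h)
    simp [markBody, Cmd.eval, step, State.set, h1, hl', hco] at hs'
    subst hs'
    refine ⟨⟨⟨r0, r4, r5, r8⟩, rfl, hq, ?_, ?_, ?_, ?_, hone, htwo⟩, ?_, ?_⟩ <;> try intro x
    all_goals first
      | simp [*]; done
      | by_cases hx : x = e
        · subst hx
          simp [*]
        · simp [*, hlt x hx]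

end Program

/-! ### Correctness of the whole program -/

section Main

variable {n : ℕ}

/-- The greedy common independent set. -/
noncomputable def greedySet (M : Fin 2 → Matroid (Fin n)) : Finset (Fin n) :=
  greedy (M 0) (M 1) ∅ ∅ ∅ (List.finRange n)

lemma program_spec (M : Fin 2 → Matroid (Fin n)) (ω : ℕ → Bool) :
    ∃ s, Runs (indepOracle M) ω program (State.init n) (102 * (n + 1)) s ∧ s.queries ≤ 102 * n ∧
      s.toSet n 0 = swapped (M 0) (M 1) (greedySet M)
        ((greedySet M).filter fun e : Fin n => Stays ω e) (List.finRange n) := by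
  have hinit := Cmd.LoopFree.runs (O := indepOracle M) (ω := ω) (c := .seq (.const 5 1) (.toss 4))
    (by simp [Cmd.LoopFree]) (State.init n)
  generalize hs₁ : Cmd.eval (indepOracle M) ω (.seq (.const 5 1) (.toss 4)) (State.init n) = s₁
    at hinit
  simp [Cmd.eval, step, State.set, State.init] at hs₁
  have hr₁ : Registers n (if ω 0 then 1 else 0) s₁ := by
    subst hs₁
    exact ⟨rfl, rfl, rfl, rfl⟩
  have harr₁ : ∀ a, s₁.arr a = fun _ => 0 := fun a => by rw [← hs₁]
  have hc₁ : s₁.coins = 1 := by rw [← hs₁]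
  have hq₁ : s₁.queries = 0 := by rw [← hs₁]
  -- Array 6 is never written and plays the empty set. Arrays 1 and 2 both end up holding the greedy
  -- set: one is kept for membership tests, the other is extended in the next sweep.
  obtain ⟨s₂, hrun₂, h₂⟩ := sweep_spec (M := M) (ω := ω) (i := 0) (t := 6) (a := 1) (b := 2)
    (T := ∅) (S := ∅) (W := ∅) (by decide) (by decide) (by decide) (by decide) (by decide)
    (by decide) (Finset.Subset.refl _) hr₁ (by simp [harr₁]) (by simp [harr₁]) (by simp [harr₁])
    (by simp [harr₁])
  change SweepInv _ _ _ _ _ _ _ _ (greedySet M) _ at h₂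
  set T := greedySet M
  have harr₂ : ∀ a, a ≠ 1 → a ≠ 2 → a ≠ 0 → s₂.arr a = fun _ => 0 := fun a h1 h2 h0 => by
    rw [h₂.frame a h1 h2 h0, harr₁]
  have hT₁ : support n (s₂.arr 1) = T := by rw [h₂.first, Finset.empty_union]
  have hT₂ : support n (s₂.arr 2) = T := by rw [h₂.second, Finset.empty_union]
  have hT₀ : support n (s₂.arr 0) = T := by rw [h₂.out, Finset.empty_union]
  -- The invariant determines the marked set from the tape, so the fold carries only a trivial
  -- `Unit` value.
  obtain ⟨s₃, hrun₃, h₃⟩ := runs_forEach (O := indepOracle M) (ω := ω) (k := 19) (c := markBody)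
    (fun (b : Unit) _ => b) (fun j _ => MarkInv ω s₂ T j)
    (fun j _ s s' h harr hcoins hqueries hvar =>
      ⟨h.regs.of_var hvar, by rw [hcoins, h.coins], by rw [hqueries, h.queries],
        by rw [harr]; exact h.zero, by rw [harr]; exact h.three, by rw [harr]; exact h.four,
        by rw [harr]; exact h.five, by rw [harr, h.one], by rw [harr, h.two]⟩)
    (fun e _ s h h1 => markBody_spec hT₁ e s h h1) (b := ()) (s := s₂) h₂.regs.size
    ⟨h₂.regs, by rw [h₂.coins, hc₁], rfl, fun x => by simp [← mem_support, hT₀],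
      fun x => by simp [harr₂], fun x => by simp [harr₂], fun x => by simp [harr₂], rfl, rfl⟩
  set S := T.filter fun e : Fin n => Stays ω e with hS
  have hST : S ⊆ T := Finset.filter_subset _ _
  have h₃0 : support n (s₃.arr 0) = S := by
    ext x
    simp [mem_support, h₃.zero, hS]
  have h₃3 : support n (s₃.arr 3) = S := by
    ext x
    simp [mem_support, h₃.three, hS]
  have h₃4 : support n (s₃.arr 4) = T := by
    ext x
    simp [mem_support, h₃.four]
  have h₃5 : support n (s₃.arr 5) = S := by
    ext x
    simp [mem_support, h₃.five, hS]
  obtain ⟨s₄, hrun₄, h₄⟩ := sweep_spec (M := M) (ω := ω) (i := 0) (t := 1) (a := 2) (b := 3)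
    (by decide) (by decide) (by decide) (by decide) (by decide) (by decide) hST h₃.regs
    (by rw [h₃.one, hT₁]) (by rw [h₃.two, hT₂]) h₃3 h₃0
  obtain ⟨s₅, hrun₅, h₅⟩ := sweep_spec (M := M) (ω := ω) (i := 1) (t := 1) (a := 4) (b := 5)
    (by decide) (by decide) (by decide) (by decide) (by decide) (by decide) hST h₄.regs
    (by rw [h₄.frame 1 (by decide) (by decide) (by decide), h₃.one, hT₁])
    (by rw [h₄.frame 4 (by decide) (by decide) (by decide), h₃4])
    (by rw [h₄.frame 5 (by decide) (by decide) (by decide), h₃5]) h₄.out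
  refine ⟨s₅, (hinit.seq (hrun₂.seq (hrun₃.seq (hrun₄.seq hrun₅)))).mono ?_, ?_, h₅.out⟩
  -- Three sweeps and the marking pass take `3 * (26 * n + 5) + (24 * n + 5)` steps; initialization
  -- and sequencing add 7, giving `102 * n + 27`.
  · simp only [Cmd.size]
    omega
  · have := h₂.queries
    have := h₃.queries
    have := h₄.queries
    have := h₅.queries
    omega

lemma greedySet_spec (M : Fin 2 → Matroid (Fin n)) :
    (M 0).Indep (greedySet M : Set (Fin n)) ∧ (M 1).Indep (greedySet M : Set (Fin n)) ∧
      ∀ e, e ∉ greedySet M → (M 0).Indep ((insert e (greedySet M) : Finset (Fin n)) : Set (Fin n)) →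
        ¬ (M 1).Indep ((insert e (greedySet M) : Finset (Fin n)) : Set (Fin n)) := by
  obtain ⟨-, -, h₁, h₂⟩ := greedy_spec (M₁ := M 0) (M₂ := M 1) (T := ∅) (S := ∅) (A := ∅)
    (l := List.finRange n) (by simp) (by simp) (by simp)
  rw [Finset.empty_union] at h₁ h₂
  exact ⟨h₁, h₂, fun e => greedy_maximal (by simp) (by simp) e (List.mem_finRange e)⟩

lemma exists_card_eq_opt (M : Fin 2 → Matroid (Fin n)) :
    ∃ I : Finset (Fin n), (∀ i, (M i).Indep (I : Set (Fin n))) ∧ I.card = opt M := by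
  classical
  obtain ⟨I, hI, hc⟩ := Finset.exists_mem_eq_sup
    (Finset.univ.filter fun I : Finset (Fin n) => ∀ i, (M i).Indep (I : Set (Fin n)))
    ⟨∅, by simp⟩ Finset.card
  refine ⟨I, (Finset.mem_filter.1 hI).2, ?_⟩
  rw [opt, hc]

end Main
end MatroidIntersection

open MatroidIntersection in
theorem corollary2 :
    ∃ (δ : ℝ) (C : ℕ) (P : MatroidIntersection.Cmd), 0 < δ ∧
      ∀ (n : ℕ) (M : Fin 2 → Matroid (Fin n)), (∀ i, (M i).E = Set.univ) →
        (∀ ω : ℕ → Bool,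
          (MatroidIntersection.run P (MatroidIntersection.indepOracle M) ω (C * (n + 1))).1 = [] ∧
          (MatroidIntersection.run P (MatroidIntersection.indepOracle M) ω
            (C * (n + 1))).2.queries ≤ C * n ∧
          ∀ i, (M i).Indep
            (MatroidIntersection.output P (MatroidIntersection.indepOracle M) ω
              (C * (n + 1)) : Set (Fin n))) ∧
        (1 / 2 + δ) * (MatroidIntersection.opt M : ℝ) ≤
          MatroidIntersection.expectedSize P (MatroidIntersection.indepOracle M)
            (C * (n + 1)) := by
  -- `1 / 24` is `13 / 24 - 1 / 2`, and `102 = 3 * 26 + 24` comes from the running time.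
  refine ⟨1 / 24, 102, program, by norm_num, fun n M _ => ?_⟩
  obtain ⟨h₀, h₁, hmax⟩ := greedySet_spec M
  have hout : ∀ ω : ℕ → Bool, output program (indepOracle M) ω (102 * (n + 1)) =
      swapped (M 0) (M 1) (greedySet M) ((greedySet M).filter fun e : Fin n => Stays ω e)
        (List.finRange n) := fun ω => by
    obtain ⟨s, hrun, -, hs⟩ := program_spec M ω
    rw [output, hrun.run_eq le_rfl]
    exact hs
  refine ⟨fun ω => ?_, ?_⟩
  · obtain ⟨s, hrun, hq, -⟩ := program_spec M ω
    refine ⟨by rw [hrun.run_eq le_rfl], by rw [hrun.run_eq le_rfl]; exact hq, ?_⟩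
    rw [hout, Fin.forall_fin_two]
    exact ⟨swapped_indep_left h₀ h₁ hmax (Finset.filter_subset _ _),
      swapped_indep_right h₀ h₁ hmax (Finset.filter_subset _ _)⟩
  · obtain ⟨I, hI, hc⟩ := exists_card_eq_opt M
    set t := 102 * (n + 1) with ht
    -- Position 0 of the tape holds the coin `j` choosing the branch, hence the shift by one.
    let idx : Fin n → Fin t := fun e => ⟨e + 1, by omega⟩
    let j : Fin t := ⟨0, by omega⟩
    have hidx : Function.Injective idx := fun e f h => by
      simpa [idx, Fin.ext_iff] using h
    have hj : ∀ u, idx u ≠ j := fun u h => by simp [idx, j] at h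
    have key := card_le_sum_card_swapped hidx hj h₀ h₁ hmax (hI 0) (hI 1) List.mem_finRange
    have hset : ∀ w : Fin t → Bool,
        ((greedySet M).filter fun e : Fin n => Stays (tape w) e) =
          if w j then unmarked idx w (greedySet M) else greedySet M := fun w => by
      have htj : tape w 0 = w j := dif_pos j.2
      have hti : ∀ e : Fin n, tape w (e + 1) = w (idx e) := fun e => dif_pos (idx e).2
      cases hw : w j <;> simp [Stays, htj, hti, hw, unmarked]
    rw [expectedSize, le_div_iff₀ (by positivity)]
    simp_rw [hout, hset]
    rw [hc, Fintype.card_fin] at key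
    have key' : (13 : ℝ) * (2 ^ t * opt M) ≤ 24 * ∑ w : Fin t → Bool,
        ((swapped (M 0) (M 1) (greedySet M)
          (if w j then unmarked idx w (greedySet M) else greedySet M)
          (List.finRange n)).card : ℝ) := by
      exact_mod_cast key
    linarith
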